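/- Let $1\le m\le n$ be integers, let $\mathscr{M}$ be a compact $m$-dimensional $C^1$-manifold (Hausdorff, without boundary), and let $f:\mathscr{M}\to\mathbb{R}^n$ be a $C^1$-immersion, i.e. a $C^1$ map whose differential is injective at every point. Then $f(\mathscr{M})\in\mathscr{A}^m(\alpha,M)$ for all $\alpha>0$ and all $M>0$. Here the admissibility class $\mathscr{A}^m(\alpha,M)$ is defined as follows. Let $\mathscr{G}(n,m)$ be the set of $m$-dimensional linear subspaces of $\mathbb{R}^n$; for $F\in\mathscr{G}(n,m)$ let $\Pi_F$ and $\Pi_{F^\perp}$ be the orthogonal projections of $\mathbb{R}^n$ onto $F$ and $F^\perp$, and put $\sphericalangle(F,G):=\|\Pi_F-\Pi_G\|$ (operator norm). For $x\in\mathbb{R}^n$ let $\Pi_{x+F}(z):=x+\Pi_F(z-x)$ and, for $\beta>0$, let $C_x(\beta,F):=\{z\in\mathbb{R}^n: |\Pi_{F^\perp}(z-x)|\le\beta\,|\Pi_F(z-x)|\}$. Let $B_r(x)$ be the open ball of radius $r$ about $x$, and $\mathscr{H}^m$ the $m$-dimensional Hausdorff measure. A set $\Sigma\subset\mathbb{R}^n$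 belongs to $\mathscr{A}^m(\alpha,M)$ if and only if $\Sigma$ is closed and there exist a function $H:\Sigma\to\mathscr{G}(n,m)$ and a dense subset $\Sigma^*\subset\Sigma$ such that for every compact set $K\subset\Sigma$ there are a radius $R_K\in(0,1]$ and a constant $c_K>0$ with the following property: for every $p\in\Sigma^*\cap K$ there is a dense subset $D_p$ of $(p+H(p))\cap B_{R_K}(p)$ such that for every $x\in D_p$ there exists a point $\eta_x\in\Sigma\cap C_p(\alpha,H(p))$ with $\Pi_{p+H(p)}(\eta_x)=x$ and $$\mathscr{H}^m\big(E_{\alpha,M}(p)\cap B_r(\eta_x)\big)\ \ge\ c_K\,r^m\qquad\text{for all } r\in(0,R_K/10^5],$$ where $E_{\alpha,M}(p):=\{\mu\in\Sigma:\ \sphericalangle(H(\mu),H(p))<M\alpha\}$. -/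

import Mathlib

open scoped Manifold MeasureTheory

noncomputable section

namespace MoebiusAdmissible

/-- Euclidean `n`-space `ℝⁿ`. -/
abbrev E (n : ℕ) : Type := EuclideanSpace ℝ (Fin n)

/-- The Grassmannian `𝒢(n,m)` of all `m`-dimensional linear subspaces of `ℝⁿ`. -/
abbrev Grassmannian (n m : ℕ) : Type :=
  {F : Submodule ℝ (E n) // Module.finrank ℝ F = m}

/-- The angle metric `∠(F,G) = ‖Π_F - Π_G‖` (operator norm), where `Π_F` is the orthogonal
projection of `ℝⁿ` onto `F`. -/
def angle {n m : ℕ} (F G : Grassmannian n m) : ℝ :=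
  ‖F.1.starProjection - G.1.starProjection‖

/-- The affine `m`-plane `x + F`. -/
def affinePlane {n m : ℕ} (x : E n) (F : Grassmannian n m) : Set (E n) :=
  {z | z - x ∈ F.1}

/-- The orthogonal projection `Π_{x+F}(z) = x + Π_F(z - x)` onto the affine plane `x + F`. -/
def affineProj {n m : ℕ} (x : E n) (F : Grassmannian n m) (z : E n) : E n :=
  x + F.1.starProjection (z - x)

/-- The cone `C_x(β,F) = {z : |Π_{F^⊥}(z - x)| ≤ β |Π_F(z - x)|}`. -/
def cone {n m : ℕ} (x : E n) (β : ℝ) (F : Grassmannian n m) : Set (E n) :=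
  {z | ‖F.1ᗮ.starProjection (z - x)‖ ≤ β * ‖F.1.starProjection (z - x)‖}

/-- `E_{α,M}(p) = {μ ∈ Σ : ∠(H(μ),H(p)) < M α}`, as a subset of `ℝⁿ`. -/
def goodSet {n m : ℕ} (α M : ℝ) {S : Set (E n)} (H : S → Grassmannian n m) (p : S) :
    Set (E n) :=
  {μ | ∃ hμ : μ ∈ S, angle (H ⟨μ, hμ⟩) (H p) < M * α}

/-- The admissibility class `𝒜^m(α,M)` of subsets `S` of `ℝⁿ` (for `1 ≤ m ≤ n`, `α, M > 0`).
The set `SStar` is dense in `S` for the subspace topology. The measure `μH[m]` is Mathlib's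
`m`-dimensional Hausdorff measure; its normalization (a positive factor depending only on `m`)
is immaterial because the constant `c` is only required to be positive. -/
def admissibilityClass (n m : ℕ) (α M : ℝ) : Set (Set (E n)) :=
  {S | IsClosed S ∧
    ∃ H : S → Grassmannian n m, ∃ SStar : Set S, Dense SStar ∧
      ∀ K : Set (E n), K ⊆ S → IsCompact K →
        ∃ R c : ℝ, 0 < R ∧ R ≤ 1 ∧ 0 < c ∧
          ∀ p : S, p ∈ SStar → (p : E n) ∈ K →
            ∃ D : Set (E n),
              D ⊆ affinePlane (p : E n) (H p) ∩ Metric.ball (p : E n) R ∧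
              affinePlane (p : E n) (H p) ∩ Metric.ball (p : E n) R ⊆ closure D ∧
              ∀ x ∈ D, ∃ η ∈ S ∩ cone (p : E n) α (H p),
                affineProj (p : E n) (H p) η = x ∧
                ∀ r : ℝ, 0 < r → r ≤ R / 10 ^ 5 →
                  ENNReal.ofReal (c * r ^ m) ≤
                    μH[(m : ℝ)] (goodSet α M H p ∩ Metric.ball η r)}

/-- A `C¹`-immersion of an `m`-dimensional manifold into `ℝⁿ`: a `C¹` map whose differential is
injective at every point. -/
def IsC1Immersion {n m : ℕ} {X : Type*} [TopologicalSpace X]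
    [ChartedSpace (EuclideanSpace ℝ (Fin m)) X] (f : X → E n) : Prop :=
  ContMDiff (𝓡 m) 𝓘(ℝ, E n) 1 f ∧
    ∀ x : X, Function.Injective (mfderiv (𝓡 m) 𝓘(ℝ, E n) f x)

end MoebiusAdmissible

end

/-! For each point of the image choose one preimage and let `H` be the tangent plane there. Near the
chosen preimage of `p` the immersion is a `C¹` graph over `p + H(p)` with small slope and slowly
turning tangent planes. This gives `η` in the cone over each `x`, with mass at least `c r^m` around
it, and compactness makes the constants uniform (`exists_uniform_tangent_graph`).

The difficulty is self-intersection: at a point of the sheet, `H` may be the tangent plane of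
another sheet. Points with two distinct tangent planes form an `ℋ^m`-null set
(`hausdorffMeasure_tangentPlane_ne_eq_zero`), since two sheets are tangent at almost every common
point: a retraction onto one sheet fixes the common points, and at density points of their parameter
set this identity can be differentiated. Removing a null set leaves the mass bound intact. -/

noncomputable section

namespace MoebiusAdmissible

/-! ### Dependence of orthogonal projections on the spanning map -/

section Projections

variable {V W : Type*} [NormedAddCommGroup V] [NormedSpace ℝ V] [FiniteDimensional ℝ V]
  [NormedAddCommGroup W] [InnerProductSpace ℝ W]

/-- The tangent plane spanned by a linear map. -/
abbrev plane (A : V →L[ℝ] W) : Submodule ℝ W := LinearMap.range (A : V →ₗ[ℝ] W)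

theorem norm_starProjection_orthogonal_le_of_mem (K : Submodule ℝ W) [K.HasOrthogonalProjection]
    (x : W) {y : W} (hy : y ∈ K) : ‖Kᗮ.starProjection x‖ ≤ ‖x - y‖ := by
  have h : Kᗮ.starProjection x = Kᗮ.starProjection (x - y) := by
    rw [map_sub, Submodule.starProjection_orthogonal_apply_eq_zero hy, sub_zero]
  rw [h]
  exact Submodule.norm_starProjection_apply_le _ _

theorem norm_starProjection_sub_comp_le {A B : V →L[ℝ] W} {l ε : ℝ} (hl : 0 < l)
    (hA : ∀ v, l * ‖v‖ ≤ ‖A v‖) (hAB : ‖A - B‖ ≤ ε) :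
    ‖(plane A).starProjection - (plane B).starProjection * (plane A).starProjection‖ ≤ ε / l := by
  have hε : 0 ≤ ε := (norm_nonneg _).trans hAB
  refine ContinuousLinearMap.opNorm_le_bound _ (by positivity) fun z => ?_
  obtain ⟨v, hv⟩ : (plane A).starProjection z ∈ plane A :=
    Submodule.starProjection_apply_mem _ z
  have hv' : A v = (plane A).starProjection z := hv
  have h1 : l * ‖v‖ ≤ ‖z‖ := (hA v).trans (hv' ▸ Submodule.norm_starProjection_apply_le _ z)
  have h2 : ‖(plane B)ᗮ.starProjection (A v)‖ ≤ ‖A v - B v‖ :=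
    norm_starProjection_orthogonal_le_of_mem _ _ ⟨v, rfl⟩
  have h3 : ‖A v - B v‖ ≤ ε * ‖v‖ := by
    simpa using (A - B).le_of_opNorm_le hAB v
  rw [Submodule.starProjection_orthogonal'] at h2
  have h4 : ‖v‖ ≤ ‖z‖ / l := by rw [le_div_iff₀ hl]; linarith
  calc _ = ‖(1 - (plane B).starProjection) (A v)‖ := by simp [hv']
    _ ≤ ε * ‖v‖ := h2.trans h3
    _ ≤ ε * (‖z‖ / l) := by gcongr
    _ = _ := by ring

/-- Split `P - Q = (P - QP) - (Q - QP)`; the second term is the adjoint of `Q - PQ`, so the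
one-sided estimate bounds both. -/
theorem norm_starProjection_plane_sub_le [CompleteSpace W] {A B : V →L[ℝ] W} {l ε : ℝ} (hl : 0 < l)
    (hA : ∀ v, l * ‖v‖ ≤ ‖A v‖) (hB : ∀ v, l * ‖v‖ ≤ ‖B v‖) (hAB : ‖A - B‖ ≤ ε) :
    ‖(plane A).starProjection - (plane B).starProjection‖ ≤ 2 * (ε / l) := by
  set P := (plane A).starProjection
  set Q := (plane B).starProjection
  have h1 : ‖P - Q * P‖ ≤ ε / l := norm_starProjection_sub_comp_le hl hA hAB
  have h2 : ‖Q - P * Q‖ ≤ ε / l :=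
    norm_starProjection_sub_comp_le hl hB (by rwa [norm_sub_rev])
  have h3 : ‖Q - Q * P‖ ≤ ε / l := by
    have hP : star P = P := isSelfAdjoint_starProjection _
    have hQ : star Q = Q := isSelfAdjoint_starProjection _
    rw [← norm_star, star_sub, star_mul, hP, hQ]
    exact h2
  calc ‖P - Q‖ = ‖(P - Q * P) - (Q - Q * P)‖ := by congr 1; abel
    _ ≤ _ := norm_sub_le _ _
    _ ≤ _ := by linarith

end Projections

/-! ### Derivatives on zero sets -/

theorem isAddHaarMeasure_hausdorffMeasure_euclidean (m : ℕ) :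
    (μH[(m : ℝ)] : MeasureTheory.Measure (E m)).IsAddHaarMeasure := by
  simpa using @MeasureTheory.isAddHaarMeasure_hausdorffMeasure (E m) _ _ _ _ _

/-- At a density point of `S`, a derivative within `S` is determined by the values on `S`. -/
theorem ae_eq_zero_of_hasFDerivWithinAt_of_eqOn_zero {m n : ℕ} (hm : 1 ≤ m) {S : Set (E m)}
    (hS : MeasurableSet S) {k : E m → E n} (k' : E m → E m →L[ℝ] E n) (hk : ∀ x ∈ S, k x = 0)
    (hk' : ∀ x ∈ S, HasFDerivWithinAt k (k' x) S x) :
    μH[(m : ℝ)] {x ∈ S | k' x ≠ 0} = 0 := by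
  have := isAddHaarMeasure_hausdorffMeasure_euclidean m
  let v₀ : E m := EuclideanSpace.single ⟨0, hm⟩ 1
  have hv₀ : ‖v₀‖ = 1 := by simp [v₀]
  -- The density theorem used below concerns self-maps, so each coordinate of `k` is placed along
  -- the unit vector `v₀` of `E m`.
  let Λ : Fin n → E n →L[ℝ] E m := fun i => (EuclideanSpace.proj i).smulRight v₀
  have key : ∀ i, ∀ᵐ x ∂(μH[(m : ℝ)] : MeasureTheory.Measure (E m)).restrict S,
      (Λ i).comp (k' x) = 0 := by
    intro i
    have happ : ApproximatesLinearOn (fun x => Λ i (k x)) (0 : E m →L[ℝ] E m) S 0 := by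
      intro x hx y hy
      simp [hk x hx, hk y hy]
    have := happ.norm_fderiv_sub_le (μH[(m : ℝ)]) hS (fun x => (Λ i).comp (k' x))
      (fun x hx => (Λ i).hasFDerivAt.comp_hasFDerivWithinAt x (hk' x hx))
    filter_upwards [this] with x hx
    simpa using hx
  have h2 := (MeasureTheory.ae_restrict_iff' hS).1 (MeasureTheory.ae_all_iff.2 key)
  refine MeasureTheory.measure_mono_null ?_ h2
  rintro x ⟨hxS, hx⟩ hcon
  refine hx ?_
  ext v i
  have := congrArg norm (DFunLike.congr_fun (hcon hxS i) v)
  simpa [Λ, norm_smul, hv₀] using this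

/-! ### Quantitative local graphs of an immersion -/

section Uniform

variable {V W : Type*} [NormedAddCommGroup V] [NormedSpace ℝ V] [FiniteDimensional ℝ V]
  [NormedAddCommGroup W] [NormedSpace ℝ W]

theorem exists_ball_approx_of_injective_fderiv {F : V → W} {O : Set V} (hO : IsOpen O)
    (hF : ContDiffOn ℝ 1 F O) {u₀ : V} (hu₀ : u₀ ∈ O)
    (hinj : Function.Injective (fderiv ℝ F u₀)) {κ : ℝ} (hκ : 0 < κ) :
    ∃ l δ Λ ρ : ℝ, 0 < l ∧ 0 ≤ δ ∧ δ ≤ κ * l ∧ 0 < Λ ∧ 0 < ρ ∧ Metric.ball u₀ ρ ⊆ O ∧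
      ∀ u ∈ Metric.ball u₀ ρ, (∀ v, l * ‖v‖ ≤ ‖fderiv ℝ F u v‖) ∧ ‖fderiv ℝ F u‖ ≤ Λ ∧
        (∀ w ∈ Metric.ball u₀ ρ, ‖fderiv ℝ F w - fderiv ℝ F u‖ ≤ δ) ∧
        ∀ x ∈ Metric.ball u₀ ρ, ∀ y ∈ Metric.ball u₀ ρ,
          ‖F y - F x - fderiv ℝ F u (y - x)‖ ≤ δ * ‖y - x‖ := by
  set A := fderiv ℝ F u₀ with hA
  obtain ⟨K, hK, hAK⟩ := (A : V →ₗ[ℝ] W).exists_antilipschitzWith (LinearMap.ker_eq_bot.2 hinj)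
  have hK' : (0 : ℝ) < K := hK
  have hAv : ∀ v, ‖v‖ ≤ K * ‖A v‖ := fun v => by
    simpa using hAK.le_mul_dist v 0
  set l : ℝ := 1 / (2 * K) with hl
  have hl0 : 0 < l := by positivity
  have hAl : ∀ v, 2 * l * ‖v‖ ≤ ‖A v‖ := fun v => by
    have : 2 * l * ‖v‖ = ‖v‖ / K := by rw [hl]; field_simp
    rw [this, div_le_iff₀ hK', mul_comm]
    exact hAv v
  -- The bound `d ≤ l` costs at most half of the lower bound `2l` of `A`; `d ≤ κl/2` makes the
  -- oscillation `2d` at most `κl`.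
  set d : ℝ := min l (κ * l / 2) with hd
  have hd0 : 0 < d := by positivity
  have hcont : ContinuousAt (fderiv ℝ F) u₀ :=
    (hF.continuousOn_fderiv_of_isOpen hO le_rfl).continuousAt (hO.mem_nhds hu₀)
  have hev : ∀ᶠ u in nhds u₀, u ∈ O ∧ ‖fderiv ℝ F u - A‖ < d := by
    refine (hO.eventually_mem hu₀).and ?_
    have := hcont.eventually (Metric.ball_mem_nhds _ hd0)
    simpa [dist_eq_norm] using this
  obtain ⟨ρ, hρ, hball⟩ := Metric.eventually_nhds_iff_ball.1 hev
  have hdiff : ∀ u ∈ Metric.ball u₀ ρ, ∀ w ∈ Metric.ball u₀ ρ,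
      ‖fderiv ℝ F w - fderiv ℝ F u‖ ≤ 2 * d := fun u hu w hw => by
    have h1 := (hball u hu).2
    have h2 := (hball w hw).2
    calc _ = ‖(fderiv ℝ F w - A) - (fderiv ℝ F u - A)‖ := by congr 1; abel
      _ ≤ _ := norm_sub_le _ _
      _ ≤ _ := by linarith
  refine ⟨l, 2 * d, ‖A‖ + d, ρ, hl0, by positivity, ?_, by positivity, hρ,
    fun u hu => (hball u hu).1, fun u hu => ⟨fun v => ?_, ?_, hdiff u hu, fun x hx y hy => ?_⟩⟩
  · have := min_le_right l (κ * l / 2)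
    linarith
  · have h1 : ‖(fderiv ℝ F u - A) v‖ ≤ d * ‖v‖ :=
      (fderiv ℝ F u - A).le_of_opNorm_le (hball u hu).2.le v
    have h2 : ‖A v‖ ≤ ‖fderiv ℝ F u v‖ + ‖(fderiv ℝ F u - A) v‖ := by
      calc ‖A v‖ = ‖fderiv ℝ F u v - (fderiv ℝ F u - A) v‖ := by simp
        _ ≤ _ := norm_sub_le _ _
    have h3 : d * ‖v‖ ≤ l * ‖v‖ := by gcongr; exact min_le_left _ _
    linarith [hAl v]
  · calc ‖fderiv ℝ F u‖ = ‖A + (fderiv ℝ F u - A)‖ := by simp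
      _ ≤ _ := norm_add_le _ _
      _ ≤ _ := by gcongr; exact (hball u hu).2.le
  · exact (convex_ball u₀ ρ).norm_image_sub_le_of_norm_fderiv_le'
      (fun z hz => (hF.differentiableOn one_ne_zero).differentiableAt
        (hO.mem_nhds (hball z hz).1)) (fun z hz => hdiff u hu z hz) hx hy

end Uniform

/-- The projected map is `δ`-close to a surjection onto `plane A` having a right inverse of norm
`l⁻¹`, so a ball of radius `σ` covers one of radius `(l - δ)σ ≥ lσ/2`. -/
theorem surjOn_orthogonal_projection {V W : Type*} [NormedAddCommGroup V] [NormedSpace ℝ V]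
    [FiniteDimensional ℝ V] [NormedAddCommGroup W] [InnerProductSpace ℝ W]
    {F : V → W} {A : V →L[ℝ] W} {l δ σ : ℝ} {u : V} (hl : 0 < l) (hδ : 0 ≤ δ) (hδl : δ ≤ l / 2)
    (hσ : 0 ≤ σ) (hA : ∀ v, l * ‖v‖ ≤ ‖A v‖)
    (hF : ∀ x ∈ Metric.closedBall u σ, ∀ y ∈ Metric.closedBall u σ,
      ‖F y - F x - A (y - x)‖ ≤ δ * ‖y - x‖)
    {z : W} (hz : z ∈ plane A) (hzσ : ‖z‖ ≤ l / 2 * σ) :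
    ∃ w ∈ Metric.closedBall u σ, (plane A).starProjection (F w - F u) = z := by
  let A' : V →L[ℝ] plane A := A.codRestrict (plane A) fun v => ⟨v, rfl⟩
  have hsurj : ∀ y : plane A, ∃ v, A v = y := fun y => y.2
  choose g hg using hsurj
  let R : A'.NonlinearRightInverse :=
    { toFun := g
      nnnorm := ⟨l⁻¹, by positivity⟩
      bound' := fun y => by
        have := hA (g y)
        rw [hg] at this
        change ‖g y‖ ≤ l⁻¹ * ‖(y : W)‖
        rw [inv_mul_eq_div, le_div_iff₀ hl]
        linarith
      right_inv' := fun y => Subtype.ext (hg y) }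
  let G : V → plane A := fun x => (plane A).orthogonalProjectionOnto (F x)
  have happ : ApproximatesLinearOn G A' (Metric.closedBall u σ) ⟨δ, hδ⟩ := by
    intro y hy x hx
    have h1 : (plane A).orthogonalProjectionOnto (A (y - x)) = A' (y - x) :=
      Submodule.orthogonalProjectionOnto_mem_subspace_eq_self (A' (y - x))
    have h2 : G y - G x - A' (y - x) =
        (plane A).orthogonalProjectionOnto (F y - F x - A (y - x)) := by
      rw [← h1, ← map_sub, ← map_sub]
    rw [h2]
    exact (Submodule.norm_orthogonalProjectionOnto_apply_le _ _).trans (hF x hx y hy)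
  have hs := happ.surjOn_closedBall_of_nonlinearRightInverse R hσ subset_rfl
  have hmem : G u + ⟨z, hz⟩ ∈ Metric.closedBall (G u) (((R.nnnorm : ℝ)⁻¹ - (δ : ℝ)) * σ) := by
    rw [mem_closedBall_iff_norm, add_sub_cancel_left]
    change ‖z‖ ≤ ((l⁻¹)⁻¹ - δ) * σ
    rw [inv_inv]
    refine hzσ.trans ?_
    gcongr
    linarith
  obtain ⟨w, hw, hwz⟩ := hs hmem
  refine ⟨w, hw, ?_⟩
  have := congrArg Subtype.val hwz
  rw [map_sub]
  exact sub_eq_iff_eq_add'.2 this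

theorem le_hausdorffMeasure_image_ball {m n : ℕ} (hm : 1 ≤ m) {F : E m → E n} {b r : ℝ} {w : E m}
    (hb : 0 < b) (hr : 0 ≤ r)
    (hF : ∀ x ∈ Metric.ball w r, ∀ y ∈ Metric.ball w r, b * ‖y - x‖ ≤ ‖F y - F x‖) :
    ENNReal.ofReal ((b * r) ^ m) * μH[(m : ℝ)] (Metric.ball (0 : E m) 1) ≤
      μH[(m : ℝ)] (F '' Metric.ball w r) := by
  have := isAddHaarMeasure_hausdorffMeasure_euclidean m
  have : Nontrivial (E m) := by
    have : Nonempty (Fin m) := ⟨⟨0, hm⟩⟩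
    infer_instance
  set B := Metric.ball w r
  let G : B → E n := fun x => F x
  have hanti : AntilipschitzWith (Real.toNNReal b⁻¹) G := by
    refine AntilipschitzWith.of_le_mul_dist fun x y => ?_
    change dist (x : E m) y ≤ (Real.toNNReal b⁻¹ : ℝ) * dist (F x) (F y)
    rw [Real.coe_toNNReal _ (by positivity), dist_eq_norm, dist_eq_norm, inv_mul_eq_div, le_div_iff₀ hb, mul_comm]
    exact hF y y.2 x x.2
  have h1 := hanti.le_hausdorffMeasure_image (d := (m : ℝ)) (by positivity) Set.univ
  have h2 : G '' Set.univ = F '' B := by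
    ext y; simp [G]
  have h3 : μH[(m : ℝ)] (Set.univ : Set B) = μH[(m : ℝ)] B := by
    rw [← (isometry_subtype_coe (s := B)).hausdorffMeasure_image (Or.inl (by positivity))]
    simp
  rw [h2, h3, MeasureTheory.Measure.addHaar_ball _ _ hr, finrank_euclideanSpace_fin] at h1
  have hbm : ENNReal.ofReal (b ^ m) * ENNReal.ofReal b⁻¹ ^ (m : ℝ) = 1 := by
    rw [ENNReal.rpow_natCast, ← ENNReal.ofReal_pow (by positivity),
      ← ENNReal.ofReal_mul (by positivity), ← mul_pow, mul_inv_cancel₀ hb.ne']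
    simp
  calc _ = ENNReal.ofReal (b ^ m) *
        (ENNReal.ofReal (r ^ m) * μH[(m : ℝ)] (Metric.ball (0 : E m) 1)) := by
        rw [mul_pow, ENNReal.ofReal_mul (by positivity), mul_assoc]
    _ ≤ ENNReal.ofReal (b ^ m) * (ENNReal.ofReal b⁻¹ ^ (m : ℝ) * μH[(m : ℝ)] (F '' B)) :=
        mul_le_mul_right h1 _
    _ = _ := by rw [← mul_assoc, hbm, one_mul]

theorem exists_uniform_graph {m n : ℕ} (hm : 1 ≤ m) {F : E m → E n} {O : Set (E m)}
    (hO : IsOpen O) (hF : ContDiffOn ℝ 1 F O) {u₀ : E m} (hu₀ : u₀ ∈ O)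
    (hinj : Function.Injective (fderiv ℝ F u₀)) {α ε : ℝ} (hα : 0 < α) (hε : 0 < ε) :
    ∃ ρ R c : ℝ, 0 < ρ ∧ 0 < R ∧ 0 < c ∧ ∀ u ∈ Metric.ball u₀ ρ, ∀ z ∈ plane (fderiv ℝ F u),
      ‖z‖ < R → ∃ w ∈ O,
        (plane (fderiv ℝ F u)).starProjection (F w - F u) = z ∧
        ‖(plane (fderiv ℝ F u))ᗮ.starProjection (F w - F u)‖ ≤ α * ‖z‖ ∧
        ∀ r, 0 < r → r ≤ R → ∃ s ⊆ O,
          (∀ v ∈ s, ‖(plane (fderiv ℝ F v)).starProjection -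
            (plane (fderiv ℝ F u)).starProjection‖ < ε) ∧
          F '' s ⊆ Metric.ball (F w) r ∧
          ENNReal.ofReal (c * r ^ m) ≤ μH[(m : ℝ)] (F '' s) := by
  -- The three entries serve, in order, surjectivity and the lower Lipschitz bound `l/2`, the cone
  -- of aperture `α`, and planes turning by at most `2κ < ε`.
  set κ : ℝ := min (1 / 2) (min (α / 2) (ε / 4)) with hκ
  have hκ0 : 0 < κ := by positivity
  have hκ1 : κ ≤ 1 / 2 := min_le_left _ _
  have hκ2 : κ ≤ α / 2 := (min_le_right _ _).trans (min_le_left _ _)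
  have hκ3 : κ ≤ ε / 4 := (min_le_right _ _).trans (min_le_right _ _)
  obtain ⟨l, δ, Λ, ρ, hl, hδ, hδκ, hΛ, hρ, hball, H⟩ :=
    exists_ball_approx_of_injective_fderiv hO hF hu₀ hinj hκ0
  have hδl : δ ≤ l / 2 := hδκ.trans (by nlinarith)
  have := isAddHaarMeasure_hausdorffMeasure_euclidean m
  set β := μH[(m : ℝ)] (Metric.ball (0 : E m) 1) with hβ
  have hβ0 : 0 < β := Metric.measure_ball_pos _ _ one_pos
  have hβt : β ≠ ⊤ := MeasureTheory.measure_ball_lt_top.ne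
  have hβr : 0 < β.toReal := ENNReal.toReal_pos hβ0.ne' hβt
  set L : ℝ := Λ + δ with hL
  have hL0 : 0 < L := by positivity
  -- The first bound on `R` puts `w` within `ρ/4` of `u`; the second gives `r/L ≤ ρ/4`, so the ball
  -- about `w` stays in the `ρ`-ball. Its image lies in the `r`-ball by the upper Lipschitz constant
  -- `L`, and the lower constant `l/2` yields `c`.
  refine ⟨ρ / 2, min (l / 2 * (ρ / 4)) (L * (ρ / 4)), (l / 2 / L) ^ m * β.toReal, by positivity,
    by positivity, by positivity, fun u hu z hz hzR => ?_⟩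
  have hu' : u ∈ Metric.ball u₀ ρ := Metric.ball_subset_ball (by linarith) hu
  have hsub : Metric.closedBall u (ρ / 4) ⊆ Metric.ball u₀ ρ := by
    intro x hx
    rw [Metric.mem_closedBall] at hx
    rw [Metric.mem_ball] at hu ⊢
    linarith [dist_triangle x u u₀]
  obtain ⟨hAl, hAΛ, -, hAF⟩ := H u hu'
  obtain ⟨w, hw, hwz⟩ := surjOn_orthogonal_projection (σ := ρ / 4) hl hδ hδl (by positivity) hAl
    (fun x hx y hy => hAF x (hsub hx) y (hsub hy)) hz (hzR.le.trans (min_le_left _ _))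
  have hlow : ∀ x ∈ Metric.ball u₀ ρ, ∀ y ∈ Metric.ball u₀ ρ,
      l / 2 * ‖y - x‖ ≤ ‖F y - F x‖ := fun x hx y hy => by
    have h1 := hAF x hx y hy
    have h2 := hAl (y - x)
    have h3 := norm_sub_norm_le (fderiv ℝ F u (y - x)) (F y - F x)
    rw [norm_sub_rev (fderiv ℝ F u (y - x))] at h3
    have h4 : δ * ‖y - x‖ ≤ l / 2 * ‖y - x‖ := by gcongr
    linarith
  have hup : ∀ x ∈ Metric.ball u₀ ρ, ∀ y ∈ Metric.ball u₀ ρ,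
      ‖F y - F x‖ ≤ L * ‖y - x‖ := fun x hx y hy => by
    have h1 := hAF x hx y hy
    have h2 := (fderiv ℝ F u).le_of_opNorm_le hAΛ (y - x)
    have h3 := norm_sub_norm_le (F y - F x) (fderiv ℝ F u (y - x))
    rw [hL, add_mul]
    linarith
  refine ⟨w, hball (hsub hw), hwz, ?_, fun r hr hrR => ⟨Metric.ball w (r / L), ?_, ?_, ?_, ?_⟩⟩
  · have h1 := norm_starProjection_orthogonal_le_of_mem (plane (fderiv ℝ F u)) (F w - F u)
      (y := fderiv ℝ F u (w - u)) ⟨w - u, rfl⟩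
    have h2 := hAF u hu' w (hsub hw)
    -- `z` differs from the linearization only by the projection of the linearization error.
    have h3 : l / 2 * ‖w - u‖ ≤ ‖z‖ := by
      have h4 : fderiv ℝ F u (w - u) - z = (plane (fderiv ℝ F u)).starProjection
          (fderiv ℝ F u (w - u) - (F w - F u)) := by
        rw [map_sub (plane (fderiv ℝ F u)).starProjection, hwz, Submodule.starProjection_eq_self_iff.2]
        exact ⟨w - u, rfl⟩
      have h5 : ‖fderiv ℝ F u (w - u) - z‖ ≤ δ * ‖w - u‖ := by
        rw [h4]
        refine (Submodule.norm_starProjection_apply_le _ _).trans ?_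
        rwa [norm_sub_rev]
      have h6 := norm_sub_norm_le (fderiv ℝ F u (w - u)) z
      have h7 : δ * ‖w - u‖ ≤ l / 2 * ‖w - u‖ := by gcongr
      linarith [hAl (w - u)]
    have h8 : δ * ‖w - u‖ ≤ α * (l / 2 * ‖w - u‖) := by
      have : δ ≤ α * (l / 2) := hδκ.trans (by nlinarith)
      calc _ ≤ α * (l / 2) * ‖w - u‖ := by gcongr
        _ = _ := by ring
    exact h1.trans (h2.trans (h8.trans (by gcongr)))
  all_goals
    have hrL : r / L ≤ ρ / 4 := by
      rw [div_le_iff₀ hL0, mul_comm]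
      exact hrR.trans (min_le_right _ _)
    have hwsub : Metric.ball w (r / L) ⊆ Metric.ball u₀ ρ := by
      intro x hx
      rw [Metric.mem_closedBall] at hw
      rw [Metric.mem_ball] at hu hx ⊢
      linarith [dist_triangle x w u₀, dist_triangle w u u₀]
  · exact hwsub.trans hball
  · intro v hv
    obtain ⟨hv1, -, hv2, -⟩ := H v (hwsub hv)
    have h1 := norm_starProjection_plane_sub_le (ε := δ) hl hv1 hAl
      (by rw [norm_sub_rev]; exact hv2 u hu')
    refine h1.trans_lt ?_
    have : δ / l ≤ κ := by rwa [div_le_iff₀ hl]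
    linarith
  · rintro _ ⟨x, hx, rfl⟩
    rw [mem_ball_iff_norm]
    refine (hup w (hsub hw) x (hwsub hx)).trans_lt ?_
    rw [mem_ball_iff_norm, lt_div_iff₀ hL0] at hx
    linarith
  · refine le_trans (le_of_eq ?_) (le_hausdorffMeasure_image_ball hm (half_pos hl)
      (div_pos hr hL0).le fun x hx y hy => hlow x (hwsub hx) y (hwsub hy))
    rw [mul_right_comm, ← mul_pow, ENNReal.ofReal_mul (by positivity),
      ENNReal.ofReal_toReal hβt]
    congr 3
    ring

/-- Near a point where its derivative is injective, a `C¹` map is fixed by post-composition with a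
map whose derivatives have range in the tangent planes. -/
theorem exists_differentiable_retraction {m n : ℕ} {F : E m → E n} {u₀ : E m}
    (hF : ContDiffAt ℝ 1 F u₀) (hinj : Function.Injective (fderiv ℝ F u₀)) :
    ∃ G : E n → E n, ∀ᶠ u in nhds u₀, G (F u) = F u ∧ DifferentiableAt ℝ G (F u) ∧
      plane (fderiv ℝ G (F u)) ≤ plane (fderiv ℝ F u) := by
  obtain ⟨g, hg⟩ := (fderiv ℝ F u₀ : E m →ₗ[ℝ] E n).exists_leftInverse_of_injective
    (LinearMap.ker_eq_bot.2 hinj)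
  -- As `L ∘ F` has derivative the identity at `u₀`, it has a local inverse `ψ`. The retraction is
  -- `F ∘ ψ ∘ L`, whose derivative factors through that of `F`.
  let L : E n →L[ℝ] E m := LinearMap.toContinuousLinearMap g
  have hLF : ContDiffAt ℝ 1 (fun u => L (F u)) u₀ := L.contDiff.contDiffAt.comp u₀ hF
  have hd : HasFDerivAt (fun u => L (F u))
      ((ContinuousLinearEquiv.refl ℝ (E m) : E m ≃L[ℝ] E m) : E m →L[ℝ] E m) u₀ := by
    have h1 := L.hasFDerivAt.comp u₀ (hF.differentiableAt one_ne_zero).hasFDerivAt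
    refine h1.congr_fderiv ?_
    ext1 v
    exact LinearMap.congr_fun hg v
  let ψ := hLF.localInverse hd one_ne_zero
  have hψ0 : ψ (L (F u₀)) = u₀ := hLF.localInverse_apply_image hd one_ne_zero
  have hψ : ContDiffAt ℝ 1 ψ (L (F u₀)) := hLF.to_localInverse hd one_ne_zero
  have hψinv : ∀ᶠ u in nhds u₀, ψ (L (F u)) = u :=
    (hLF.hasStrictFDerivAt' hd one_ne_zero).eventually_left_inverse
  have hcont : Filter.Tendsto (fun u => L (F u)) (nhds u₀) (nhds (L (F u₀))) :=
    hLF.continuousAt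
  have hψd : ∀ᶠ u in nhds u₀, ContDiffAt ℝ 1 ψ (L (F u)) :=
    hcont.eventually (hψ.eventually (by simp))
  refine ⟨fun y => F (ψ (L y)), ?_⟩
  filter_upwards [hψinv, hψd, hF.eventually (by simp)] with u h1 h2 h3
  have h4 : HasFDerivAt F (fderiv ℝ F u) (ψ (L (F u))) := by
    rw [h1]; exact (h3.differentiableAt one_ne_zero).hasFDerivAt
  have h5 := h4.comp (F u)
    ((h2.differentiableAt one_ne_zero).hasFDerivAt.comp (F u) L.hasFDerivAt)
  refine ⟨by simp only [h1], h5.differentiableAt, ?_⟩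
  have h6 : fderiv ℝ (fun y => F (ψ (L y))) (F u) = _ := h5.fderiv
  rw [h6]
  rintro _ ⟨v, rfl⟩
  exact ⟨_, rfl⟩

/-! ### Tangent planes of an immersed manifold -/

section Immersion

variable {m n : ℕ} {X : Type*} [TopologicalSpace X] [ChartedSpace (EuclideanSpace ℝ (Fin m)) X]

/-- The image of the differential of `f` at `x`, as a linear subspace of `ℝⁿ`. -/
def tangentPlane (m : ℕ) {n : ℕ} {X : Type*} [TopologicalSpace X]
    [ChartedSpace (EuclideanSpace ℝ (Fin m)) X] (f : X → E n) (x : X) : Submodule ℝ (E n) :=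
  plane (V := E m) (W := E n) (mfderiv (𝓡 m) 𝓘(ℝ, E n) f x)

theorem finrank_tangentPlane {f : X → E n} (hf : IsC1Immersion (m := m) f) (x : X) :
    Module.finrank ℝ (tangentPlane m f x) = m := by
  have h : Function.Injective
      ((show E m →L[ℝ] E n from mfderiv (𝓡 m) 𝓘(ℝ, E n) f x) : E m →ₗ[ℝ] E n) := hf.2 x
  exact (LinearMap.finrank_range_of_inj h).trans finrank_euclideanSpace_fin

variable [IsManifold (𝓡 m) 1 X]

theorem contDiffOn_comp_chartAt_symm {f : X → E n} (hf : IsC1Immersion (m := m) f) (a : X) :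
    ContDiffOn ℝ 1 (f ∘ (chartAt (E m) a).symm) (chartAt (E m) a).target := by
  rw [← contMDiffOn_iff_contDiffOn]
  exact hf.1.comp_contMDiffOn (contMDiffOn_chart_symm (I := 𝓡 m))

theorem fderiv_comp_chartAt_symm {f : X → E n} (hf : IsC1Immersion (m := m) f) (a : X)
    {u : E m} (hu : u ∈ (chartAt (E m) a).target) :
    Function.Injective (fderiv ℝ (f ∘ (chartAt (E m) a).symm) u) ∧
      plane (fderiv ℝ (f ∘ (chartAt (E m) a).symm) u) =
        tangentPlane m f ((chartAt (E m) a).symm u) := by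
  set e := chartAt (E m) a
  have he : e.symm.MDifferentiable (𝓡 m) (𝓡 m) := (mdifferentiable_chart a).symm
  have h := mfderiv_comp (I := 𝓡 m) (I' := 𝓡 m) (I'' := 𝓘(ℝ, E n)) u
    (hf.1.mdifferentiable one_ne_zero (e.symm u)) (he.mdifferentiableAt hu)
  rw [mfderiv_eq_fderiv] at h
  have hcoe : ∀ v, fderiv ℝ (f ∘ e.symm) u v =
      mfderiv (𝓡 m) 𝓘(ℝ, E n) f (e.symm u) (mfderiv (𝓡 m) (𝓡 m) e.symm u v) :=
    fun v => congrArg (fun A : E m →L[ℝ] E n => A v) h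
  constructor
  · intro v w hvw
    rw [hcoe, hcoe] at hvw
    exact he.mfderiv_injective hu (hf.2 _ hvw)
  · ext y
    constructor
    · rintro ⟨v, rfl⟩
      exact ⟨mfderiv (𝓡 m) (𝓡 m) e.symm u v, (hcoe v).symm⟩
    · rintro ⟨w, rfl⟩
      obtain ⟨v, rfl⟩ := he.mfderiv_surjective hu w
      exact ⟨v, hcoe v⟩

/-! ### Null multiple tangency and uniform graphs in the compact case -/

variable [CompactSpace X]

/-- With `G` the retraction for the sheet at `b`, `F = G ∘ F` on the parameters of common points.
Hence `DF = DG ∘ DF` there outside a null set, and the range of `DG` lies in the tangent plane at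
`y`. Lipschitz maps preserve null sets. -/
theorem exists_nhds_hausdorffMeasure_not_le_eq_zero [T2Space X] (hm : 1 ≤ m) {f : X → E n}
    (hf : IsC1Immersion (m := m) f) (a b : X) :
    ∃ U ∈ nhds a, ∃ W ∈ nhds b, μH[(m : ℝ)]
      (f '' {x ∈ U | ∃ y ∈ W, f y = f x ∧ ¬ tangentPlane m f x ≤ tangentPlane m f y}) = 0 := by
  set e := chartAt (E m) a with he
  set F : E m → E n := f ∘ e.symm with hF
  have hea : e a ∈ e.target := mem_chart_target (E m) a
  have hFO : ContDiffOn ℝ 1 F e.target := contDiffOn_comp_chartAt_symm hf a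
  obtain ⟨C, t, ht, hlip⟩ :=
    (hFO.contDiffAt (e.open_target.mem_nhds hea)).exists_lipschitzOnWith
  obtain ⟨r, hr, hball⟩ := Metric.nhds_basis_closedBall.mem_iff.1
    (Filter.inter_mem ht (e.open_target.mem_nhds hea))
  set B := Metric.closedBall (e a) r
  set e' := chartAt (E m) b
  have heb : e' b ∈ e'.target := mem_chart_target (E m) b
  obtain ⟨G, hG⟩ := exists_differentiable_retraction
    ((contDiffOn_comp_chartAt_symm hf b).contDiffAt (e'.open_target.mem_nhds heb))
    (fderiv_comp_chartAt_symm hf b heb).1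
  have hGb : ∀ᶠ y in nhds b, G (f y) = f y ∧ DifferentiableAt ℝ G (f y) ∧
      plane (fderiv ℝ G (f y)) ≤ tangentPlane m f y := by
    filter_upwards [(e'.continuousAt (mem_chart_source (E m) b)).eventually hG,
      e'.open_source.mem_nhds (mem_chart_source (E m) b)] with y hy hys
    rw [(fderiv_comp_chartAt_symm hf b (e'.map_source hys)).2] at hy
    have hinv : (chartAt (E m) b).symm (e' y) = y := e'.left_inv hys
    simpa only [Function.comp_apply, hinv] using hy
  -- A compact `W` makes `f '' W` closed, hence `S` measurable.
  obtain ⟨W, ⟨hW, hWc⟩, hWG⟩ := (compact_basis_nhds b).mem_iff.1 hGb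
  have hclosed : IsClosed (f '' W) := (hWc.image hf.1.continuous).isClosed
  set S := B ∩ F ⁻¹' (f '' W)
  have hS : IsClosed S :=
    (hFO.continuousOn.mono fun u hu => (hball hu).2).preimage_isClosed_of_isClosed
      Metric.isClosed_closedBall hclosed
  have hGS : ∀ u ∈ S, G (F u) = F u ∧ DifferentiableAt ℝ G (F u) := by
    rintro u ⟨-, y, hy, hyu⟩
    rw [← hyu]
    exact ⟨(hWG hy).1, (hWG hy).2.1⟩
  have hFd : ∀ u ∈ B, HasFDerivAt F (fderiv ℝ F u) u := fun u hu =>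
    ((hFO.differentiableOn one_ne_zero).differentiableAt
      (e.open_target.mem_nhds (hball hu).2)).hasFDerivAt
  have hnull := ae_eq_zero_of_hasFDerivWithinAt_of_eqOn_zero hm hS.measurableSet
    (k := fun u => F u - G (F u))
    (fun u => fderiv ℝ F u - (fderiv ℝ G (F u)).comp (fderiv ℝ F u))
    (fun u hu => by rw [(hGS u hu).1, sub_self])
    (fun u hu => ((hFd u hu.1).sub
      ((hGS u hu).2.hasFDerivAt.comp u (hFd u hu.1))).hasFDerivWithinAt)
  refine ⟨e.source ∩ e ⁻¹' B, Filter.inter_mem (e.open_source.mem_nhds (mem_chart_source (E m) a))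
    ((e.continuousAt (mem_chart_source (E m) a)).preimage_mem_nhds
      (Metric.closedBall_mem_nhds _ hr)), W, hW, ?_⟩
  set Z := {u ∈ S | fderiv ℝ F u - (fderiv ℝ G (F u)).comp (fderiv ℝ F u) ≠ 0}
  have hZ : μH[(m : ℝ)] (F '' Z) = 0 := by
    have h := (hlip.mono fun u (hu : u ∈ Z) => (hball hu.1.1).1).hausdorffMeasure_image_le
      (d := (m : ℝ)) (by positivity)
    rw [hnull, mul_zero] at h
    exact le_antisymm h zero_le
  refine MeasureTheory.measure_mono_null ?_ hZ
  rintro _ ⟨x, ⟨⟨hxs, hxB⟩, y, hy, hyx, hxy⟩, rfl⟩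
  have hFx : F (e x) = f x := by simp [F, e.left_inv hxs]
  refine ⟨e x, ⟨⟨hxB, y, hy, by rw [hFx, hyx]⟩, fun h0 => hxy ?_⟩, hFx⟩
  have h1 := (fderiv_comp_chartAt_symm hf a (e.map_source hxs)).2
  rw [← he, e.left_inv hxs] at h1
  rw [← h1]
  refine le_trans ?_ (hWG hy).2.2
  rw [hyx, ← hFx]
  rintro _ ⟨v, rfl⟩
  have h2 := DFunLike.congr_fun (sub_eq_zero.1 h0) v
  exact ⟨fderiv ℝ F (e x) v, h2.symm⟩

/-- Almost every point of the image of a compact immersed manifold has only one tangent plane. -/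
theorem hausdorffMeasure_tangentPlane_ne_eq_zero [T2Space X] (hm : 1 ≤ m) {f : X → E n}
    (hf : IsC1Immersion (m := m) f) :
    μH[(m : ℝ)] (f '' {x | ∃ y, f y = f x ∧ tangentPlane m f y ≠ tangentPlane m f x}) = 0 := by
  have key : μH[(m : ℝ)] (f '' {x | ∃ y, (x, y) ∈ (Set.univ : Set (X × X)) ∧ f y = f x ∧
      ¬ tangentPlane m f x ≤ tangentPlane m f y}) = 0 := by
    refine isCompact_univ.induction_on (p := fun s : Set (X × X) => μH[(m : ℝ)]
      (f '' {x | ∃ y, (x, y) ∈ s ∧ f y = f x ∧ ¬ tangentPlane m f x ≤ tangentPlane m f y}) = 0)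
      (by simp) ?_ ?_ ?_
    · intro s t hst ht
      refine MeasureTheory.measure_mono_null (Set.image_mono ?_) ht
      rintro x ⟨y, hxy, h⟩
      exact ⟨y, hst hxy, h⟩
    · intro s t hs ht
      refine MeasureTheory.measure_mono_null ?_ (MeasureTheory.measure_union_null hs ht)
      rw [← Set.image_union]
      refine Set.image_mono ?_
      rintro x ⟨y, hxy | hxy, h⟩
      · exact Or.inl ⟨y, hxy, h⟩
      · exact Or.inr ⟨y, hxy, h⟩
    · rintro ⟨a, b⟩ -
      obtain ⟨U, hU, W, hW, h⟩ := exists_nhds_hausdorffMeasure_not_le_eq_zero hm hf a b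
      refine ⟨U ×ˢ W, mem_nhdsWithin_of_mem_nhds (prod_mem_nhds hU hW), ?_⟩
      refine MeasureTheory.measure_mono_null (Set.image_mono ?_) h
      rintro x ⟨y, hxy, h⟩
      exact ⟨hxy.1, y, hxy.2, h⟩
  refine MeasureTheory.measure_mono_null (Set.image_mono ?_) key
  rintro x ⟨y, hyx, hne⟩
  -- Both planes have dimension `m`, so inclusion would force equality.
  refine ⟨y, Set.mem_univ _, hyx, fun hle => hne ?_⟩
  exact (Submodule.eq_of_le_of_finrank_eq hle
    ((finrank_tangentPlane hf x).trans (finrank_tangentPlane hf y).symm)).symm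

/-- Uniform local graph representation of a compact immersed manifold over its tangent planes. -/
theorem exists_uniform_tangent_graph (hm : 1 ≤ m) {f : X → E n}
    (hf : IsC1Immersion (m := m) f) {α ε : ℝ} (hα : 0 < α) (hε : 0 < ε) :
    ∃ R c : ℝ, 0 < R ∧ R ≤ 1 ∧ 0 < c ∧ ∀ a : X, ∀ z ∈ tangentPlane m f a, ‖z‖ < R →
      ∃ b : X, (tangentPlane m f a).starProjection (f b - f a) = z ∧
        ‖(tangentPlane m f a)ᗮ.starProjection (f b - f a)‖ ≤ α * ‖z‖ ∧
        ∀ r, 0 < r → r ≤ R → ENNReal.ofReal (c * r ^ m) ≤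
          μH[(m : ℝ)] (f '' {x | ‖(tangentPlane m f x).starProjection -
            (tangentPlane m f a).starProjection‖ < ε} ∩ Metric.ball (f b) r) := by
  let Q : ℝ → ℝ → X → Prop := fun R c a => ∀ z ∈ tangentPlane m f a, ‖z‖ < R →
      ∃ b : X, (tangentPlane m f a).starProjection (f b - f a) = z ∧
        ‖(tangentPlane m f a)ᗮ.starProjection (f b - f a)‖ ≤ α * ‖z‖ ∧
        ∀ r, 0 < r → r ≤ R → ENNReal.ofReal (c * r ^ m) ≤
          μH[(m : ℝ)] (f '' {x | ‖(tangentPlane m f x).starProjection -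
            (tangentPlane m f a).starProjection‖ < ε} ∩ Metric.ball (f b) r)
  -- Shrinking both constants is harmless, so a finite cover can be handled by taking minima.
  have hmono : ∀ {R R' c c' a}, R' ≤ R → c' ≤ c → Q R c a → Q R' c' a := by
    intro R R' c c' a hR hc hQ z hz hzR
    obtain ⟨b, h1, h2, h3⟩ := hQ z hz (hzR.trans_le hR)
    refine ⟨b, h1, h2, fun r hr hrR => le_trans ?_ (h3 r hr (hrR.trans hR))⟩
    gcongr
  have key : ∃ R c : ℝ, 0 < R ∧ R ≤ 1 ∧ 0 < c ∧ ∀ a ∈ (Set.univ : Set X), Q R c a := by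
    refine isCompact_univ.induction_on
      (p := fun s : Set X => ∃ R c : ℝ, 0 < R ∧ R ≤ 1 ∧ 0 < c ∧ ∀ a ∈ s, Q R c a)
      ⟨1, 1, one_pos, le_rfl, one_pos, by simp⟩ ?_ ?_ ?_
    · rintro s t hst ⟨R, c, hR, hR1, hc, h⟩
      exact ⟨R, c, hR, hR1, hc, fun a ha => h a (hst ha)⟩
    · rintro s t ⟨R, c, hR, hR1, hc, h⟩ ⟨R', c', hR', hR1', hc', h'⟩
      refine ⟨min R R', min c c', lt_min hR hR', (min_le_left _ _).trans hR1, lt_min hc hc', ?_⟩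
      rintro a (ha | ha)
      · exact hmono (min_le_left _ _) (min_le_left _ _) (h a ha)
      · exact hmono (min_le_right _ _) (min_le_right _ _) (h' a ha)
    · rintro a₀ -
      set e := chartAt (E m) a₀
      have hea : e a₀ ∈ e.target := mem_chart_target (E m) a₀
      obtain ⟨ρ, R, c, hρ, hR, hc, h⟩ := exists_uniform_graph hm e.open_target
        (contDiffOn_comp_chartAt_symm hf a₀) hea (fderiv_comp_chartAt_symm hf a₀ hea).1 hα hε
      refine ⟨e.source ∩ e ⁻¹' Metric.ball (e a₀) ρ, mem_nhdsWithin_of_mem_nhds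
        (Filter.inter_mem (e.open_source.mem_nhds (mem_chart_source (E m) a₀))
          ((e.continuousAt (mem_chart_source (E m) a₀)).preimage_mem_nhds
            (Metric.ball_mem_nhds _ hρ))), min R 1, c, by positivity, min_le_right _ _, hc, ?_⟩
      rintro a ⟨has, haB⟩
      refine hmono (min_le_left R 1) le_rfl fun z hz hzR => ?_
      have ht : e a ∈ e.target := e.map_source has
      have h' := h (e a) haB
      simp only [(fderiv_comp_chartAt_symm hf a₀ ht).2] at h'
      have hinv : (chartAt (E m) a₀).symm (e a) = a := e.left_inv has
      simp only [Function.comp_apply, hinv] at h'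
      obtain ⟨w, -, h1, h2, h3⟩ := h' z hz hzR
      refine ⟨e.symm w, h1, h2, fun r hr hrR => ?_⟩
      obtain ⟨s, hs, h4, h5, h6⟩ := h3 r hr hrR
      refine h6.trans (MeasureTheory.measure_mono (Set.subset_inter ?_ h5))
      rintro _ ⟨v, hv, rfl⟩
      refine ⟨e.symm v, ?_, rfl⟩
      have h7 := h4 v hv
      simp only [(fderiv_comp_chartAt_symm hf a₀ (hs hv)).2] at h7
      exact h7
  obtain ⟨R, c, hR, hR1, hc, h⟩ := key
  exact ⟨R, c, hR, hR1, hc, fun a => h a (Set.mem_univ a)⟩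

end Immersion

end MoebiusAdmissible

end

theorem mainTheorem6 (m n : ℕ) (hm : 1 ≤ m) (hmn : m ≤ n)
    (X : Type*) [TopologicalSpace X] [T2Space X] [CompactSpace X]
    [ChartedSpace (EuclideanSpace ℝ (Fin m)) X] [IsManifold (𝓡 m) 1 X]
    (f : X → MoebiusAdmissible.E n) (hf : MoebiusAdmissible.IsC1Immersion (m := m) f)
    (α M : ℝ) (hα : 0 < α) (hM : 0 < M) :
    Set.range f ∈ MoebiusAdmissible.admissibilityClass n m α M := by
  open MoebiusAdmissible in
  refine ⟨(isCompact_range hf.1.continuous).isClosed, ?_⟩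
  choose g hg using fun y : Set.range f => y.2
  let H : Set.range f → Grassmannian n m :=
    fun y => ⟨tangentPlane m f (g y), finrank_tangentPlane hf (g y)⟩
  -- No exceptional base points are needed, and the constants do not depend on `K`.
  refine ⟨H, Set.univ, dense_univ, fun K _ _ => ?_⟩
  obtain ⟨R, c, hR, hR1, hc, h⟩ := exists_uniform_tangent_graph hm hf hα (mul_pos hM hα)
  refine ⟨R, c, hR, hR1, hc, fun p _ _ => ⟨_, subset_rfl, subset_closure, ?_⟩⟩
  rintro x ⟨hx, hxR⟩
  obtain ⟨b, h1, h2, h3⟩ := h (g p) (x - p) hx (by rwa [← mem_ball_iff_norm])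
  rw [hg p] at h1 h2
  refine ⟨f b, ⟨⟨b, rfl⟩, ?_⟩, ?_, fun r hr hrR => ?_⟩
  · change ‖(tangentPlane m f (g p))ᗮ.starProjection (f b - p)‖ ≤
      α * ‖(tangentPlane m f (g p)).starProjection (f b - p)‖
    rwa [h1]
  · change (p : E n) + (tangentPlane m f (g p)).starProjection (f b - p) = x
    rw [h1, add_sub_cancel]
  · refine (h3 r hr (hrR.trans (div_le_self hR.le (by norm_num)))).trans ?_
    -- Off the null set of multiple tangent planes, the plane at the chosen preimage of `f x` equals
    -- the plane at `x`.
    rw [← MeasureTheory.measure_sdiff_null (hausdorffMeasure_tangentPlane_ne_eq_zero hm hf)]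
    refine MeasureTheory.measure_mono ?_
    rintro _ ⟨⟨⟨x, hx, rfl⟩, hxr⟩, hxN⟩
    refine ⟨⟨⟨x, rfl⟩, ?_⟩, hxr⟩
    have hT : tangentPlane m f (g ⟨f x, ⟨x, rfl⟩⟩) = tangentPlane m f x := by
      by_contra hne
      exact hxN ⟨x, ⟨_, hg ⟨f x, ⟨x, rfl⟩⟩, hne⟩, rfl⟩
    change ‖(tangentPlane m f (g ⟨f x, ⟨x, rfl⟩⟩)).starProjection -
      (tangentPlane m f (g p)).starProjection‖ < M * α
    simp only [hT]
    exact hx
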